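/- Let $n,m,T\in\mathbb N$ and $n_\alpha,n_\beta\ge 1$, and let $\Omega\subset\mathbb R^n\times\mathbb R^m$ be a convex polytope. Consider a two-layer network $\mathcal N_\theta(x,u)=Wz^\star(x,u)+c$, where, with $y=\mathrm{col}(x,u)$, $z^\star(x,u)$ minimizes $\tfrac12 z^\top Qz+(p+Ry)^\top z$ over $z\in\mathbb R^{2n}$ subject to $Fz+Gy\le h$. Its weights $R,p,G,h$ are arbitrary (trained), and $Q=H$ for a positive definite diagonal $H\in\mathbb R^{2n\times 2n}$, $W=[I_n\ \,-I_n]$, $c=0$, $F=-S$, where for $z=(\alpha,\beta)\in\mathbb R^n\times\mathbb R^n$ the vector $Sz$ consists of $n_\alpha$ copies of $\alpha$ and $n_\beta$ copies of $\beta$. Thus, writing $-Q^{-1}(Ry+p)=(A_\psi x+B_\psi u+c_\psi,\;A_\phi x+B_\phi u+c_\phi)$ and $Gy-h=(A_{\alpha,i}x+B_{\alpha,i}u+c_{\alpha,i})_{i\le n_\alpha},\,(A_{\beta,j}x+B_{\beta,j}u+c_{\beta,j})_{j\le n_\beta}$, the constraints read $\alpha\ge A_{\alpha,i}x+B_{\alpha,i}u+c_{\alpha,i}$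 and $\beta\ge A_{\beta,j}x+B_{\beta,j}u+c_{\beta,j}$ for all $i,j$. The network gives the linear complementarity model $$x^+=Ax+B_uu+B_ww+d,\qquad 0\le E_ww+E_xx+E_uu+e\perp w\ge 0,$$ with $[A\ B_u]=-WQ^{-1}R$, $B_w=-WQ^{-1}F^\top$, $d=-WQ^{-1}p$, $E_w=FQ^{-1}F^\top$, $[E_x\ E_u]=FQ^{-1}R-G$, $e=FQ^{-1}p+h$. Assume: 1. for every $(x,u)\in\Omega$ all solutions $w$ of the complementarity problem give the same $x^+$; 2. the complementarity problem decomposes into blocks: the indices are partitioned into blocks $K$, and there are $\mu_K>0$ such that $(E_w)_{ij}=\mu_K$ if $i,j$ lie in the same block $K$ and $(E_w)_{ij}=0$ if $i,j$ lie in different blocks (singleton blocks: $E_w$ is diagonal with positive entries); 3. for every $(x,u)\in\Omega$ some component of $E_xx+E_uu+e$ is negative; 4. componentwise, for all $(x,u)\in\Omega$, $A_\psi x+B_\psi u+c_\psi<\max_i\{A_{\alpha,i}x+B_{\alpha,i}u+c_{\alpha,i}\}$ and $A_\phi x+B_\phi u+c_\phi<\max_j\{A_{\beta,j}x+B_{\beta,j}u+c_{\beta,j}\}$.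 Let $\ell_t:\mathbb R^n\times\mathbb R^m\to\mathbb R$ ($0\le t<T$) and $\ell_T:\mathbb R^n\to\mathbb R$ be convex, let $x(0)\in\mathbb R^n$, and consider the optimal control problem with complementarity constraints $$\min_{\boldsymbol x,\boldsymbol u,\boldsymbol w}\ \ell_T(x_T)+\sum_{t<T}\ell_t(x_t,u_t)\quad\text{s.t.}\quad x_{t+1}=Ax_t+B_uu_t+B_ww_t+d,\quad 0\le E_ww_t+E_xx_t+E_uu_t+e\perp w_t\ge 0\ \ (0\le t<T),\quad x_0=x(0).$$ Let $(\boldsymbol x^\star,\boldsymbol u^\star,\boldsymbol w^\star)$ be feasible for this problem, with $(x_t^\star,u_t^\star)\in\Omega$ for all $t<T$. Then $(\boldsymbol x^\star,\boldsymbol u^\star,\boldsymbol w^\star)$ is locally optimal if and only if there are Lagrange multipliers which together with it satisfy the standard KKT conditions of the problem, viewed as a nonlinear program with equality constraints given by the dynamics, the initial condition and $(E_ww_t+E_xx_t+E_uu_t+e)^\top w_t=0$, and inequality constraints $E_ww_t+E_xx_t+E_uu_t+e\ge0$, $w_t\ge0$ (in the stationarity condition, the gradient of the convex cost is replaced by a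 subgradient, which is the gradient where the cost is differentiable). -/

import Mathlib

namespace HybridNN

open Matrix

/-! ## Nonlinear programs and their KKT conditions -/

/-- The nonlinear program `min f z` subject to `eqc i z = 0` and `ineqc j z ≤ 0`. -/
structure NLP (E I J : Type) where
  f : E → ℝ
  eqc : I → E → ℝ
  ineqc : J → E → ℝ

/-- `φ` is a subgradient of `f` at `z`, in the sense of convex analysis. For a convex `f` that is
differentiable at `z`, the derivative of `f` at `z` is the only subgradient. -/
def IsSubgradient {E : Type} [NormedAddCommGroup E] [NormedSpace ℝ E]
    (f : E → ℝ) (z : E) (φ : E →L[ℝ] ℝ) : Prop :=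
  ∀ z' : E, f z + φ (z' - z) ≤ f z'

namespace NLP

variable {E I J : Type}

def Feasible (P : NLP E I J) (z : E) : Prop :=
  (∀ i, P.eqc i z = 0) ∧ ∀ j, P.ineqc j z ≤ 0

/-- Local optimality: feasible, and no feasible point in some neighbourhood has a smaller cost. -/
def IsLocallyOptimal [TopologicalSpace E] (P : NLP E I J) (z : E) : Prop :=
  P.Feasible z ∧ IsLocalMinOn P.f {z' | P.Feasible z'} z

/-- The standard KKT conditions for the primal point `z` and the multipliers `lam` (equality
constraints, free sign) and `mu` (inequality constraints): primal feasibility, dual feasibility,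
complementary slackness, and stationarity of the Lagrangian. The constraint functions enter through
their derivatives, the (convex, possibly nonsmooth) cost through a subgradient. -/
structure IsKKT [NormedAddCommGroup E] [NormedSpace ℝ E] [Fintype I] [Fintype J]
    (P : NLP E I J) (z : E) (lam : I → ℝ) (mu : J → ℝ) : Prop where
  primal : P.Feasible z
  dual : ∀ j, 0 ≤ mu j
  slack : ∀ j, mu j * P.ineqc j z = 0
  stationary : ∃ φ : E →L[ℝ] ℝ, IsSubgradient P.f z φ ∧
    φ + ∑ i, lam i • fderiv ℝ (P.eqc i) z + ∑ j, mu j • fderiv ℝ (P.ineqc j) z = 0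

end NLP

/-! ## Linear complementarity models -/

/-- The linear complementarity model
`x⁺ = A x + Bu u + Bw w + d`, `0 ≤ Ew w + Ex x + Eu u + e ⊥ w ≥ 0`,
with states in `ℝⁿ`, inputs in `ℝᵐ` and complementarity variables indexed by `ι`. -/
structure LCModel (n m : ℕ) (ι : Type) where
  A : Matrix (Fin n) (Fin n) ℝ
  Bu : Matrix (Fin n) (Fin m) ℝ
  Bw : Matrix (Fin n) ι ℝ
  d : Fin n → ℝ
  Ew : Matrix ι ι ℝ
  Ex : Matrix ι (Fin n) ℝ
  Eu : Matrix ι (Fin m) ℝ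
  e : ι → ℝ

namespace LCModel

variable {n m : ℕ} {ι : Type} [Fintype ι]

/-- The successor state `A x + Bu u + Bw w + d`. -/
def next (M : LCModel n m ι) (x : Fin n → ℝ) (u : Fin m → ℝ) (w : ι → ℝ) : Fin n → ℝ :=
  M.A *ᵥ x + M.Bu *ᵥ u + M.Bw *ᵥ w + M.d

/-- The slack `Ew w + Ex x + Eu u + e`. -/
def slack (M : LCModel n m ι) (x : Fin n → ℝ) (u : Fin m → ℝ) (w : ι → ℝ) : ι → ℝ :=
  M.Ew *ᵥ w + M.Ex *ᵥ x + M.Eu *ᵥ u + M.e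

/-- `w` solves `0 ≤ Ew w + Ex x + Eu u + e ⊥ w ≥ 0`. -/
def Solves (M : LCModel n m ι) (x : Fin n → ℝ) (u : Fin m → ℝ) (w : ι → ℝ) : Prop :=
  (∀ i, 0 ≤ M.slack x u w i) ∧ (∀ i, 0 ≤ w i) ∧ M.slack x u w ⬝ᵥ w = 0

/-- Deterministic behaviour: for every state-input pair, all solutions of the complementarity
problem give the same successor state. -/
def Deterministic (M : LCModel n m ι) (Ω : Set ((Fin n → ℝ) × (Fin m → ℝ))) : Prop :=
  ∀ x u, (x, u) ∈ Ω → ∀ w w', M.Solves x u w → M.Solves x u w' → M.next x u w = M.next x u w'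

/-- Decomposition of the complementarity problem: the complementarity variables split into blocks
(`blk i` is the label of the block of `i`), and row `i` of the problem reads
`0 ≤ μ (blk i) * ∑ j in the block of i, w j + D i x + G i u + e i ⊥ w i ≥ 0` with `μ (blk i) > 0`,
where `D i`, `G i` are the rows of `Ex`, `Eu`. For `blk = id` this is the elementwise
decomposition `Ew = diag μ`. -/
def Decomposable (M : LCModel n m ι) : Prop :=
  ∃ (blk : ι → ι) (μ : ι → ℝ), (∀ i, 0 < μ i) ∧
    (∀ i j, blk i = blk j → M.Ew i j = μ (blk i)) ∧ (∀ i j, blk i ≠ blk j → M.Ew i j = 0)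

/-- Nontriviality: for every state-input pair, `D i x + G i u + e i < 0` for some `i`. -/
def Nontrivial (M : LCModel n m ι) (Ω : Set ((Fin n → ℝ) × (Fin m → ℝ))) : Prop :=
  ∀ x u, (x, u) ∈ Ω → ∃ i, (M.Ex *ᵥ x + M.Eu *ᵥ u + M.e) i < 0

end LCModel

/-! ## The optimal control problem -/

/-- Trajectories `(x, u, w)` with `x = (x_0, …, x_T)`, `u = (u_0, …, u_{T-1})`,
`w = (w_0, …, w_{T-1})`. -/
abbrev Traj (n m : ℕ) (ι : Type) (T : ℕ) : Type :=
  (Fin (T + 1) → Fin n → ℝ) × (Fin T → Fin m → ℝ) × (Fin T → ι → ℝ)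

/-- Equality constraints: dynamics (time, component), initial state (component),
orthogonality (time). -/
abbrev EqIdx (n T : ℕ) : Type := (Fin T × Fin n) ⊕ Fin n ⊕ Fin T

/-- Inequality constraints: nonnegativity of the slack and of `w` (time, component). -/
abbrev IneqIdx (ι : Type) (T : ℕ) : Type := (Fin T × ι) ⊕ (Fin T × ι)

/-- The optimal control problem with complementarity constraints
`min ℓ_T(x_T) + ∑ ℓ_t(x_t, u_t)` subject to `x_{t+1} = A x_t + Bu u_t + Bw w_t + d`,
`0 ≤ Ew w_t + Ex x_t + Eu u_t + e ⊥ w_t ≥ 0` for `t < T`, and `x_0 = x0`. -/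
def ocp {n m : ℕ} {ι : Type} [Fintype ι] (M : LCModel n m ι) (T : ℕ)
    (ell : Fin T → (Fin n → ℝ) × (Fin m → ℝ) → ℝ) (ellT : (Fin n → ℝ) → ℝ) (x0 : Fin n → ℝ) :
    NLP (Traj n m ι T) (EqIdx n T) (IneqIdx ι T) where
  f := fun (x, u, _) => ellT (x (Fin.last T)) + ∑ t : Fin T, ell t (x t.castSucc, u t)
  eqc := fun i (x, u, w) => match i with
    | .inl (t, k) => x t.succ k - M.next (x t.castSucc) (u t) (w t) k
    | .inr (.inl k) => x 0 k - x0 k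
    | .inr (.inr t) => M.slack (x t.castSucc) (u t) (w t) ⬝ᵥ w t
  ineqc := fun j (x, u, w) => match j with
    | .inl (t, i) => -M.slack (x t.castSucc) (u t) (w t) i
    | .inr (t, i) => -w t i

/-! ## The neural network -/

/-- The weights of a two-layer network: an OptNet layer, which maps `y = col(x, u)` to the
minimizer `z` of `½ zᵀ Q z + (p + R y)ᵀ z` subject to `F z + G y ≤ h`, followed by the affine
layer `x⁺ = W z + c`. -/
structure Network (n m : ℕ) (σ ι : Type) where
  Q : Matrix σ σ ℝ
  R : Matrix σ (Fin n ⊕ Fin m) ℝ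
  p : σ → ℝ
  F : Matrix ι σ ℝ
  G : Matrix ι (Fin n ⊕ Fin m) ℝ
  h : ι → ℝ
  W : Matrix (Fin n) σ ℝ
  c : Fin n → ℝ

namespace Network

variable {n m : ℕ} {σ ι : Type} [Fintype σ] [DecidableEq σ] [Fintype ι]

/-- The cost of the quadratic program of the OptNet layer. -/
noncomputable def qpCost (N : Network n m σ ι) (x : Fin n → ℝ) (u : Fin m → ℝ) (z : σ → ℝ) : ℝ :=
  (1 / 2) * (z ⬝ᵥ N.Q *ᵥ z) + (N.p + N.R *ᵥ Sum.elim x u) ⬝ᵥ z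

/-- The constraints of the quadratic program of the OptNet layer. -/
def qpFeasible (N : Network n m σ ι) (x : Fin n → ℝ) (u : Fin m → ℝ) : Set (σ → ℝ) :=
  {z | ∀ i, (N.F *ᵥ z + N.G *ᵥ Sum.elim x u) i ≤ N.h i}

/-- `xp` is the output of the network at the input `(x, u)`. -/
def IsOutput (N : Network n m σ ι) (x : Fin n → ℝ) (u : Fin m → ℝ) (xp : Fin n → ℝ) : Prop :=
  ∃ z ∈ N.qpFeasible x u, IsMinOn (N.qpCost x u) (N.qpFeasible x u) z ∧ xp = N.W *ᵥ z + N.c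

/-- The linear complementarity model of a network with `Q` positive definite and `c = 0`. The
complementarity variable is the multiplier of `F z + G y ≤ h`. -/
noncomputable def toLC (N : Network n m σ ι) : LCModel n m ι where
  A := (-(N.W * N.Q⁻¹ * N.R)).toCols₁
  Bu := (-(N.W * N.Q⁻¹ * N.R)).toCols₂
  Bw := -(N.W * N.Q⁻¹ * N.Fᵀ)
  d := -((N.W * N.Q⁻¹) *ᵥ N.p)
  Ew := N.F * N.Q⁻¹ * N.Fᵀ
  Ex := (N.F * N.Q⁻¹ * N.R - N.G).toCols₁
  Eu := (N.F * N.Q⁻¹ * N.R - N.G).toCols₂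
  e := (N.F * N.Q⁻¹) *ᵥ N.p + N.h

/-- The linear complementarity model reproduces the network: a solution of the complementarity
problem at `(x, u)` yields the output of the network as successor state. -/
theorem isOutput_next
    (N : Network n m σ ι) (hQ : N.Q.PosDef) (hc : N.c = 0)
    (x : Fin n → ℝ) (u : Fin m → ℝ) (w : ι → ℝ) (hw : N.toLC.Solves x u w) :
    N.IsOutput x u (N.toLC.next x u w) := by
  obtain ⟨hs, hw0, horth⟩ := hw
  have key : ∀ {κ : Type} (B : Matrix κ (Fin n ⊕ Fin m) ℝ),
      B.toCols₁ *ᵥ x + B.toCols₂ *ᵥ u = B *ᵥ Sum.elim x u := by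
    intro κ B
    ext k
    simp [Matrix.mulVec, dotProduct, Matrix.toCols₁, Matrix.toCols₂, Fintype.sum_sum_type]
  set y : Fin n ⊕ Fin m → ℝ := Sum.elim x u with hy
  set z : σ → ℝ := -(N.Q⁻¹ *ᵥ (N.R *ᵥ y + N.p + N.Fᵀ *ᵥ w)) with hz
  have hdet : IsUnit N.Q.det := (Matrix.isUnit_iff_isUnit_det _).1 hQ.isUnit
  have hQz : N.Q *ᵥ z = -(N.R *ᵥ y + N.p + N.Fᵀ *ᵥ w) := by
    rw [hz, Matrix.mulVec_neg, Matrix.mulVec_mulVec, Matrix.mul_nonsing_inv _ hdet,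
      Matrix.one_mulVec]
  have hslack : N.toLC.slack x u w = N.h - N.F *ᵥ z - N.G *ᵥ y := by
    have h0 := key (N.F * N.Q⁻¹ * N.R - N.G)
    simp only [LCModel.slack, toLC]
    rw [add_assoc ((N.F * N.Q⁻¹ * N.Fᵀ) *ᵥ w), h0, hz]
    simp only [Matrix.mulVec_neg, Matrix.mulVec_add, Matrix.sub_mulVec, ← Matrix.mulVec_mulVec]
    abel
  have hnext : N.toLC.next x u w = N.W *ᵥ z + N.c := by
    have h0 := key (-(N.W * N.Q⁻¹ * N.R))
    simp only [LCModel.next, toLC]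
    rw [h0, hz, hc]
    simp only [Matrix.mulVec_neg, Matrix.mulVec_add, Matrix.neg_mulVec, ← Matrix.mulVec_mulVec]
    abel
  refine ⟨z, fun i => ?_, fun v hv => ?_, hnext⟩
  · have := hs i
    rw [hslack] at this
    simp only [Pi.sub_apply] at this
    simp only [Pi.add_apply]
    linarith
  · have hpsd := hQ.posSemidef.dotProduct_mulVec_nonneg (v - z)
    have hsym : z ⬝ᵥ N.Q *ᵥ v = v ⬝ᵥ N.Q *ᵥ z := by
      have : N.Qᵀ = N.Q := by simpa using hQ.isHermitian.eq
      rw [Matrix.dotProduct_mulVec, ← Matrix.mulVec_transpose, this, dotProduct_comm]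
    have hqv : (N.p + N.R *ᵥ y) = -(N.Q *ᵥ z) - N.Fᵀ *ᵥ w := by rw [hQz]; abel
    have hF : ∀ a : σ → ℝ, (N.Fᵀ *ᵥ w) ⬝ᵥ a = w ⬝ᵥ N.F *ᵥ a := fun a => by
      rw [Matrix.dotProduct_mulVec, ← Matrix.mulVec_transpose]
    have h1 : 0 ≤ w ⬝ᵥ (N.h - N.F *ᵥ v - N.G *ᵥ y) :=
      Finset.sum_nonneg fun i _ => mul_nonneg (hw0 i) (by
        have := hv i
        simp only [Pi.add_apply] at this
        simp only [Pi.sub_apply]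
        linarith)
    have h2 : w ⬝ᵥ (N.h - N.F *ᵥ z - N.G *ᵥ y) = 0 := by
      rw [← hslack, dotProduct_comm]; exact horth
    simp only [Set.mem_ofPred_eq, qpCost]
    rw [← hy, hqv]
    simp only [star_trivial, Matrix.mulVec_sub, dotProduct_sub, sub_dotProduct, hF, neg_dotProduct]
      at hpsd h1 h2 ⊢
    rw [dotProduct_comm (N.Q *ᵥ z) v, dotProduct_comm (N.Q *ᵥ z) z]
    linarith

end Network

/-- The constraints of the layer in the architecture below: `inl (k, i)` is the `k`-th component of
the `i`-th inequality for `α`, and `inr (k, j)` the `k`-th component of the `j`-th one for `β`. -/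
abbrev CIdx (n nα nβ : ℕ) : Type := (Fin n × Fin nα) ⊕ (Fin n × Fin nβ)

/-- The 0-1 matrix `S` with `(S (α, β)) (inl (k, i)) = α k` and `(S (α, β)) (inr (k, j)) = β k`. -/
def selector (n nα nβ : ℕ) : Matrix (CIdx n nα nβ) (Fin n ⊕ Fin n) ℝ :=
  Matrix.of fun i k => if Sum.map Prod.fst Prod.fst i = k then 1 else 0

namespace Network

variable {n m nα nβ : ℕ}

/-- The fixed weights of the `α`-`β` architecture, with `z = (α, β) ∈ ℝⁿ × ℝⁿ`: `Q = diag H` is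
positive definite, `F = -S`, `W = [I, -I]`, `c = 0`. The weights `R, p, G, h` are left free for the
training. The network computes `x⁺ = α - β`, where `(α, β)` minimizes
`½ ‖(α, β) - (ψ, φ)(x, u)‖²_H` subject to `α ≥ a_i(x, u)` for all `i` and `β ≥ b_j(x, u)` for all
`j`; here `(ψ, φ) = costCenter` and `(a, b) = bound` are the affine maps below. -/
structure IsAlphaBeta (N : Network n m (Fin n ⊕ Fin n) (CIdx n nα nβ))
    (H : Fin n ⊕ Fin n → ℝ) : Prop where
  H_pos : ∀ k, 0 < H k
  Q_eq : N.Q = Matrix.diagonal H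
  F_eq : N.F = -selector n nα nβ
  W_eq : N.W = Matrix.fromCols 1 (-1)
  c_eq : N.c = 0

/-- The affine map `(x, u) ↦ -Q⁻¹ R (x, u) - Q⁻¹ p`; its components `inl k` are those of
`A_ψ x + B_ψ u + c_ψ`, its components `inr k` those of `A_φ x + B_φ u + c_φ`. -/
noncomputable def costCenter (N : Network n m (Fin n ⊕ Fin n) (CIdx n nα nβ))
    (x : Fin n → ℝ) (u : Fin m → ℝ) : Fin n ⊕ Fin n → ℝ :=
  (-(N.Q⁻¹ * N.R)) *ᵥ Sum.elim x u - N.Q⁻¹ *ᵥ N.p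

/-- The affine map `(x, u) ↦ G (x, u) - h`; its component `inl (k, i)` is the `k`-th one of
`A_{α,i} x + B_{α,i} u + c_{α,i}`, its component `inr (k, j)` the `k`-th one of
`A_{β,j} x + B_{β,j} u + c_{β,j}`. -/
def bound (N : Network n m (Fin n ⊕ Fin n) (CIdx n nα nβ))
    (x : Fin n → ℝ) (u : Fin m → ℝ) : CIdx n nα nβ → ℝ :=
  N.G *ᵥ Sum.elim x u - N.h

/-- The strict inequalities, componentwise: `ψ < max_i a_i` and `φ < max_j b_j` on `Ω`. -/
def StrictInequalities (N : Network n m (Fin n ⊕ Fin n) (CIdx n nα nβ))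
    (Ω : Set ((Fin n → ℝ) × (Fin m → ℝ))) : Prop :=
  ∀ x u, (x, u) ∈ Ω →
    (∀ k, N.costCenter x u (.inl k) < ⨆ i : Fin nα, N.bound x u (.inl (k, i))) ∧
    (∀ k, N.costCenter x u (.inr k) < ⨆ j : Fin nβ, N.bound x u (.inr (k, j)))

end Network

end HybridNN

/-! Two facts drive the equivalence: the cost is convex and does not see `w`, and complementarity
freezes the signs of the strictly positive quantities near a feasible point.

KKT implies local optimality. If `slack i > 0` at `z`, then `slack i > 0` at nearby feasible points,
so their `w i` vanishes; the roles of `slack` and `w` may be exchanged. Hence the displacement from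
`z` to a nearby feasible point annihilates the linearized orthogonality constraint. All other
constraints are affine, so pairing the stationarity condition with this displacement and using the
subgradient inequality gives optimality (`isLocallyOptimal_of_isKKT`).

Local optimality implies KKT. By Hahn–Banach and Farkas (`NLP.exists_isKKT`) it suffices that the
cost does not decrease along any direction of the linearized cone. Such a direction may fail to be
feasible: where `slack i = w i = 0`, both may increase at first order. The remedy is to change only
its `w` part. The successor state and the slack depend on `w` only through `Fᵀ w`, that is, through
one sum for each component of `(α, β)`. The strict inequalities force every such sum to contain a
positive `w i` (`IsAlphaBeta.exists_pos`), and this entry can absorb the entire change of the sum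
(`IsAlphaBeta.shiftable`). The modified direction is feasible for small steps and has the same cost.
-/

namespace HybridNN

open Matrix Filter Topology

/-! ### Farkas' lemma, subgradients and existence of multipliers -/

/-- **Farkas' lemma** for finitely many linear functionals on a real vector space. -/
theorem exists_nonneg_combination {V κ : Type*} [AddCommGroup V] [Module ℝ V] (s : Finset κ)
    (b : κ → V →ₗ[ℝ] ℝ) (c : V →ₗ[ℝ] ℝ) (h : ∀ d, (∀ j ∈ s, b j d ≤ 0) → c d ≤ 0) :
    ∃ mu : κ → ℝ, (∀ j, 0 ≤ mu j) ∧ c = ∑ j ∈ s, mu j • b j := by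
  classical
  induction s using Finset.induction_on generalizing b c with
  | empty =>
    refine ⟨0, fun _ => le_rfl, LinearMap.ext fun d => ?_⟩
    have h1 := h d (by simp)
    have h2 := h (-d) (by simp)
    rw [map_neg] at h2
    simpa using le_antisymm h1 (by linarith)
  | insert a s ha ih =>
    -- Either `b a` is redundant, or some `x` violates the implication for `s` alone; then `b a x >
    -- 0`, and `x` serves as a direction of projection.
    by_cases hs : ∀ d, (∀ j ∈ s, b j d ≤ 0) → c d ≤ 0
    · obtain ⟨mu, hmu, hc⟩ := ih b c hs
      refine ⟨fun j => if j = a then 0 else mu j, fun j => ?_, ?_⟩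
      · dsimp only
        split_ifs
        exacts [le_rfl, hmu j]
      · rw [Finset.sum_insert ha, hc]
        simp only [if_true, zero_smul, zero_add]
        exact Finset.sum_congr rfl fun j hj => by rw [if_neg (fun e => ha (by rwa [← e]))]
    · push Not at hs
      obtain ⟨x, hx, hcx⟩ := hs
      have hax : 0 < b a x := by
        by_contra hn
        refine absurd (h x fun j hj => ?_) (not_le.2 hcx)
        rcases Finset.mem_insert.1 hj with rfl | hj
        exacts [not_lt.1 hn, hx j hj]
      -- The new functionals are the old ones composed with the projection `d ↦ d - (b a d / b a x)
      -- • x` onto the kernel of `b a`, where the constraint `a` holds automatically.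
      obtain ⟨mu, hmu, hc⟩ := ih (fun j => b j - (b j x / b a x) • b a)
        (c - (c x / b a x) • b a) fun d hd => by
          have := h (d - (b a d / b a x) • x) fun j hj => by
            rcases Finset.mem_insert.1 hj with rfl | hj
            · simp [hax.ne']
            · have := hd j hj
              simp only [LinearMap.sub_apply, LinearMap.smul_apply, smul_eq_mul, map_sub,
                map_smul] at this ⊢
              have e : b j x / b a x * b a d = b a d / b a x * b j x := by ring
              linarith
          simp only [LinearMap.sub_apply, LinearMap.smul_apply, smul_eq_mul, map_sub,
            map_smul] at this ⊢
          have e : c x / b a x * b a d = b a d / b a x * c x := by ring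
          linarith
      refine ⟨fun j => if j = a then c x / b a x - ∑ i ∈ s, mu i * (b i x / b a x) else mu j,
        fun j => ?_, ?_⟩
      · dsimp only
        split_ifs
        · have h1 : ∑ i ∈ s, mu i * (b i x / b a x) ≤ 0 := Finset.sum_nonpos fun i hi =>
            mul_nonpos_of_nonneg_of_nonpos (hmu i)
              (div_nonpos_of_nonpos_of_nonneg (hx i hi) hax.le)
          have h2 : 0 < c x / b a x := div_pos hcx hax
          linarith
        · exact hmu j
      · rw [Finset.sum_insert ha]
        beta_reduce
        rw [if_pos rfl, Finset.sum_congr (g := fun j => mu j • b j) rfl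
          fun j hj => by rw [if_neg (fun e => ha (by rwa [← e]))]]
        rw [sub_eq_iff_eq_add] at hc
        simp only [smul_sub, Finset.sum_sub_distrib, smul_smul, ← Finset.sum_smul] at hc
        refine hc.trans (LinearMap.ext fun d => ?_)
        simp only [LinearMap.add_apply, LinearMap.sub_apply, LinearMap.smul_apply, smul_eq_mul]
        ring

/-- A convex function that attains its minimum over the translate by `z` of a convex cone at `z`
has a subgradient at `z` that is nonnegative on the cone. -/
theorem exists_isSubgradient_nonneg {E : Type} [NormedAddCommGroup E] [NormedSpace ℝ E]
    [FiniteDimensional ℝ E] {f : E → ℝ} (hf : ConvexOn ℝ Set.univ f) (z : E) {L : Set E}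
    (hL : Convex ℝ L) (h0 : (0 : E) ∈ L) (hmin : ∀ d ∈ L, f z ≤ f (z + d)) :
    ∃ φ : E →L[ℝ] ℝ, IsSubgradient f z φ ∧ ∀ d ∈ L, 0 ≤ φ d := by
  have hcont : Continuous f := hf.locallyLipschitz.continuous
  -- The strict epigraph of `d ↦ f (z + d) - f z` is open and convex, and minimality on `L` keeps it
  -- disjoint from `L × (-∞, 0]`; a separating hyperplane yields the subgradient.
  have hconv : Convex ℝ {q : E × ℝ | f (z + q.1) - f z < q.2} := by
    intro a ha b hb s t hs ht hst
    simp only [Set.mem_ofPred_eq] at ha hb ⊢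
    have h1 := hf.2 (Set.mem_univ (z + a.1)) (Set.mem_univ (z + b.1)) hs ht hst
    have h2 : s • (z + a.1) + t • (z + b.1) = z + (s • a + t • b).1 := by
      have : z = s • z + t • z := by rw [← add_smul, hst, one_smul]
      conv_rhs => rw [this]
      simp only [Prod.fst_add, Prod.smul_fst, smul_add]
      abel
    rw [h2] at h1
    simp only [Prod.snd_add, Prod.smul_snd, smul_eq_mul] at h1 ⊢
    have h3 : f z = s * f z + t * f z := by rw [← add_mul, hst, one_mul]
    rcases hs.eq_or_lt with rfl | hs
    · have : t = 1 := by linarith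
      subst this
      linarith
    · have := mul_lt_mul_of_pos_left ha hs
      have := mul_le_mul_of_nonneg_left hb.le ht
      linarith
  have hopen : IsOpen {q : E × ℝ | f (z + q.1) - f z < q.2} :=
    isOpen_lt (by fun_prop) (by fun_prop)
  obtain ⟨g, v, hg1, hg2⟩ := geometric_hahn_banach_open hconv hopen (hL.prod (convex_Iic (0 : ℝ)))
    (by
      rw [Set.disjoint_left]
      rintro ⟨d, r⟩ h1 ⟨h2, h3⟩
      have := hmin d h2
      simp only [Set.mem_ofPred_eq, Set.mem_Iic] at h1 h3
      linarith)
  have hsplit : ∀ d r, g (d, r) = g (d, 0) + r * g (0, 1) := fun d r => by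
    rw [← smul_eq_mul, ← map_smul, ← map_add]
    simp
  have hv : v ≤ 0 := (hg2 0 ⟨h0, Set.mem_Iic.2 le_rfl⟩).trans_eq (map_zero g)
  have hpos : ∀ r : ℝ, 0 < r → r * g (0, 1) < v := fun r hr => by
    have := hg1 (0, r) (by simpa using hr)
    rwa [hsplit, show ((0 : E), (0 : ℝ)) = 0 from rfl, map_zero, zero_add] at this
  have hneg : g (0, 1) < 0 := by linarith [hpos 1 one_pos]
  -- The points `(0, r)` with small `r > 0` lie in the epigraph, so a negative `v` is impossible and
  -- the hyperplane passes through the origin.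
  have hv0 : 0 ≤ v := by
    by_contra hn
    have h1 := hpos (v / 2 / g (0, 1)) (div_pos_of_neg_of_neg (by linarith) hneg)
    rw [div_mul_cancel₀ _ hneg.ne] at h1
    linarith
  refine ⟨(-g (0, 1))⁻¹ • g.comp (ContinuousLinearMap.inl ℝ E ℝ), fun z' => ?_, fun d hd => ?_⟩
  -- The epigraph is strict, so its boundary is approached from above by `ε`.
  · refine le_of_forall_pos_lt_add fun ε hε => ?_
    have h1 := hg1 (z' - z, f z' - f z + ε) (by simpa using hε)
    rw [hsplit] at h1
    simp only [_root_.smul_apply, ContinuousLinearMap.comp_apply,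
      ContinuousLinearMap.inl_apply, smul_eq_mul]
    have h2 : (-g (0, 1))⁻¹ * g (z' - z, 0) < f z' - f z + ε := by
      rw [inv_mul_lt_iff₀ (by linarith)]
      linarith
    linarith
  · simp only [_root_.smul_apply, ContinuousLinearMap.comp_apply,
      ContinuousLinearMap.inl_apply, smul_eq_mul]
    exact mul_nonneg (inv_nonneg.2 (by linarith)) (hv0.trans (hg2 (d, 0) ⟨hd, by simp⟩))

/-- A feasible point at which the convex cost is minimal along all directions of the linearized
cone satisfies the KKT conditions. -/
theorem NLP.exists_isKKT {E I J : Type} [NormedAddCommGroup E] [NormedSpace ℝ E]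
    [FiniteDimensional ℝ E] [Fintype I] [Fintype J] (P : NLP E I J) {z : E}
    (hf : ConvexOn ℝ Set.univ P.f) (hz : P.Feasible z)
    (hmin : ∀ d, (∀ i, fderiv ℝ (P.eqc i) z d = 0) →
      (∀ j, P.ineqc j z = 0 → fderiv ℝ (P.ineqc j) z d ≤ 0) → P.f z ≤ P.f (z + d)) :
    ∃ lam mu, P.IsKKT z lam mu := by
  classical
  obtain ⟨φ, hφ, hφL⟩ := exists_isSubgradient_nonneg hf z
    (L := {d | (∀ i, fderiv ℝ (P.eqc i) z d = 0) ∧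
      ∀ j, P.ineqc j z = 0 → fderiv ℝ (P.ineqc j) z d ≤ 0})
    (by
      rintro a ⟨ha1, ha2⟩ b ⟨hb1, hb2⟩ s t hs ht -
      refine ⟨fun i => by simp [ha1 i, hb1 i], fun j hj => ?_⟩
      rw [map_add, map_smul, map_smul]
      exact add_nonpos (mul_nonpos_of_nonneg_of_nonpos hs (ha2 j hj))
        (mul_nonpos_of_nonneg_of_nonpos ht (hb2 j hj)))
    ⟨by simp, by simp⟩ fun d hd => hmin d hd.1 hd.2
  -- Each equality enters with both signs, which makes its multiplier free; an inactive inequality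
  -- enters as the zero functional, so its multiplier can be set to zero.
  obtain ⟨mu, hmu, hsum⟩ := exists_nonneg_combination (Finset.univ : Finset ((I ⊕ I) ⊕ J))
    (Sum.elim (Sum.elim (fun i => (fderiv ℝ (P.eqc i) z : E →ₗ[ℝ] ℝ))
        fun i => -(fderiv ℝ (P.eqc i) z : E →ₗ[ℝ] ℝ))
      fun j => if P.ineqc j z = 0 then (fderiv ℝ (P.ineqc j) z : E →ₗ[ℝ] ℝ) else 0)
    (-(φ : E →ₗ[ℝ] ℝ)) fun d hd => by
      refine neg_nonpos.2 (hφL d ⟨fun i => le_antisymm ?_ ?_, fun j hj => ?_⟩)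
      · simpa using hd (.inl (.inl i)) (Finset.mem_univ _)
      · simpa using hd (.inl (.inr i)) (Finset.mem_univ _)
      · simpa [hj] using hd (.inr j) (Finset.mem_univ _)
  refine ⟨fun i => mu (.inl (.inl i)) - mu (.inl (.inr i)),
    fun j => if P.ineqc j z = 0 then mu (.inr j) else 0, hz, fun j => ?_, fun j => ?_, φ, hφ, ?_⟩
  · split_ifs
    exacts [hmu _, le_rfl]
  · split_ifs with hj
    · rw [hj, mul_zero]
    · rw [zero_mul]
  · ext d
    have h1 := LinearMap.congr_fun hsum d
    simp only [LinearMap.neg_apply, ContinuousLinearMap.coe_coe, LinearMap.sum_apply,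
      LinearMap.add_apply, LinearMap.smul_apply, Fintype.sum_sum_type, Sum.elim_inl, Sum.elim_inr, smul_eq_mul] at h1
    have h2 : ∀ j, mu (.inr j) *
        ((if P.ineqc j z = 0 then (fderiv ℝ (P.ineqc j) z : E →ₗ[ℝ] ℝ) else 0) d) =
        (if P.ineqc j z = 0 then mu (.inr j) else 0) * fderiv ℝ (P.ineqc j) z d := fun j => by
      split_ifs <;> simp
    simp only [h2, mul_neg, Finset.sum_neg_distrib] at h1
    simp only [_root_.add_apply, _root_.sum_apply,
      _root_.smul_apply, smul_eq_mul, sub_mul, Finset.sum_sub_distrib,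
      _root_.zero_apply]
    linarith

/-- Along a line through `z` the function is a quadratic polynomial, whose derivative at `0` is the
linear coefficient. All constraints of the control problem are of this kind; only orthogonality has
`q ≠ 0` in general. -/
theorem fderiv_apply_of_quadratic {E : Type*} [NormedAddCommGroup E] [NormedSpace ℝ E]
    {g : E → ℝ} {z d : E} {a q : ℝ} (hg : DifferentiableAt ℝ g z)
    (h : ∀ t : ℝ, g (z + t • d) = g z + t * a + t ^ 2 * q) : fderiv ℝ g z d = a := by
  rw [← hg.lineDeriv_eq_fderiv, lineDeriv, funext h]
  have h1 : HasDerivAt (fun t : ℝ => g z + t * a + t ^ 2 * q)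
      (1 * a + ((2 : ℕ) * (0 : ℝ) ^ (2 - 1) * 1) * q) 0 :=
    (((hasDerivAt_id (0 : ℝ)).mul_const a).const_add (g z)).add
      (((hasDerivAt_id (0 : ℝ)).pow 2).mul_const q)
  rw [h1.deriv]
  simp

/-! ### Linear complementarity models and their linear parts -/

namespace LCModel

variable {n m : ℕ} {ι : Type} [Fintype ι] (M : LCModel n m ι)

/-- The linear part of `LCModel.next`. -/
def nextLin (x : Fin n → ℝ) (u : Fin m → ℝ) (w : ι → ℝ) : Fin n → ℝ :=
  M.A *ᵥ x + M.Bu *ᵥ u + M.Bw *ᵥ w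

/-- The linear part of `LCModel.slack`. -/
def slackLin (x : Fin n → ℝ) (u : Fin m → ℝ) (w : ι → ℝ) : ι → ℝ :=
  M.Ew *ᵥ w + M.Ex *ᵥ x + M.Eu *ᵥ u

theorem next_add_smul (x dx : Fin n → ℝ) (u du : Fin m → ℝ) (w dw : ι → ℝ) (t : ℝ) :
    M.next (x + t • dx) (u + t • du) (w + t • dw) = M.next x u w + t • M.nextLin dx du dw := by
  simp only [next, nextLin, mulVec_add, mulVec_smul, smul_add]
  abel

theorem slack_add_smul (x dx : Fin n → ℝ) (u du : Fin m → ℝ) (w dw : ι → ℝ) (t : ℝ) :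
    M.slack (x + t • dx) (u + t • du) (w + t • dw) = M.slack x u w + t • M.slackLin dx du dw := by
  simp only [slack, slackLin, mulVec_add, mulVec_smul, smul_add]
  abel

variable {M}

theorem Solves.mul_eq_zero {x : Fin n → ℝ} {u : Fin m → ℝ} {w : ι → ℝ} (h : M.Solves x u w)
    (i : ι) : M.slack x u w i * w i = 0 :=
  (Finset.sum_eq_zero_iff_of_nonneg fun i _ => mul_nonneg (h.1 i) (h.2.1 i)).1 h.2.2 i
    (Finset.mem_univ i)

/-- Every direction in `w` can be replaced by one that is supported on the positive components of
`w` and that has the same effect on the successor state and on the slack. -/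
def Shiftable (M : LCModel n m ι) (w : ι → ℝ) : Prop :=
  ∀ dw : ι → ℝ, ∃ dw' : ι → ℝ, (∀ i, w i = 0 → dw' i = 0) ∧
    M.Bw *ᵥ dw' = M.Bw *ᵥ dw ∧ M.Ew *ᵥ dw' = M.Ew *ᵥ dw

end LCModel

/-! ### Constraints of the control problem and their derivatives -/

section OptimalControl

variable {n m T : ℕ} {ι : Type} [Fintype ι] {M : LCModel n m ι}
  {ell : Fin T → (Fin n → ℝ) × (Fin m → ℝ) → ℝ} {ellT : (Fin n → ℝ) → ℝ} {x0 : Fin n → ℝ}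

theorem ocp_feasible_iff (z : Traj n m ι T) : (ocp M T ell ellT x0).Feasible z ↔
    (∀ t, z.1 t.succ = M.next (z.1 t.castSucc) (z.2.1 t) (z.2.2 t)) ∧ z.1 0 = x0 ∧
      ∀ t, M.Solves (z.1 t.castSucc) (z.2.1 t) (z.2.2 t) := by
  constructor
  · rintro ⟨h1, h2⟩
    exact ⟨fun t => funext fun k => sub_eq_zero.1 (h1 (.inl (t, k))),
      funext fun k => sub_eq_zero.1 (h1 (.inr (.inl k))),
      fun t => ⟨fun i => neg_nonpos.1 (h2 (.inl (t, i))), fun i => neg_nonpos.1 (h2 (.inr (t, i))),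
        h1 (.inr (.inr t))⟩⟩
  · rintro ⟨h1, h2, h3⟩
    refine ⟨?_, ?_⟩
    · rintro (⟨t, k⟩ | k | t)
      · exact sub_eq_zero.2 (congrFun (h1 t) k)
      · exact sub_eq_zero.2 (congrFun h2 k)
      · exact (h3 t).2.2
    · rintro (⟨t, i⟩ | ⟨t, i⟩)
      · exact neg_nonpos.2 ((h3 t).1 i)
      · exact neg_nonpos.2 ((h3 t).2.1 i)

variable (z d : Traj n m ι T)

theorem differentiable_slack (t : Fin T) (i : ι) : Differentiable ℝ fun z : Traj n m ι T =>
    M.slack (z.1 t.castSucc) (z.2.1 t) (z.2.2 t) i := by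
  simp only [LCModel.slack, mulVec, dotProduct, Pi.add_apply]
  fun_prop

/-- With `eventually_pos`, this fixes the strictly positive side of each complementarity pair near
`z`, as both implications require. -/
theorem eventually_slack_pos : ∀ᶠ z' in 𝓝 z, ∀ t i,
    0 < M.slack (z.1 t.castSucc) (z.2.1 t) (z.2.2 t) i →
      0 < M.slack (z'.1 t.castSucc) (z'.2.1 t) (z'.2.2 t) i := by
  simp only [eventually_all]
  exact fun t i hi => continuousAt_const.eventually_lt
    (differentiable_slack (M := M) t i).continuous.continuousAt hi

theorem eventually_pos : ∀ᶠ z' in 𝓝 z, ∀ t i, 0 < z.2.2 t i → 0 < z'.2.2 t i := by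
  simp only [eventually_all]
  exact fun t i hi => continuousAt_const.eventually_lt
    (g := fun z' : Traj n m ι T => z'.2.2 t i) (by fun_prop) hi

theorem fderiv_ocp_dynamics (t : Fin T) (k : Fin n) :
    fderiv ℝ ((ocp M T ell ellT x0).eqc (.inl (t, k))) z d =
      d.1 t.succ k - M.nextLin (d.1 t.castSucc) (d.2.1 t) (d.2.2 t) k := by
  refine fderiv_apply_of_quadratic (q := 0) ?_ fun r => ?_
  · change DifferentiableAt ℝ (fun z : Traj n m ι T =>
      z.1 t.succ k - M.next (z.1 t.castSucc) (z.2.1 t) (z.2.2 t) k) z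
    simp only [LCModel.next, mulVec, dotProduct, Pi.add_apply]
    fun_prop
  · have := congrFun (M.next_add_smul (z.1 t.castSucc) (d.1 t.castSucc) (z.2.1 t) (d.2.1 t)
      (z.2.2 t) (d.2.2 t) r) k
    change (z.1 t.succ k + r * d.1 t.succ k) - M.next (z.1 t.castSucc + r • d.1 t.castSucc)
      (z.2.1 t + r • d.2.1 t) (z.2.2 t + r • d.2.2 t) k =
      (z.1 t.succ k - M.next (z.1 t.castSucc) (z.2.1 t) (z.2.2 t) k) + _ + _
    rw [this]
    simp only [Pi.add_apply, Pi.smul_apply, smul_eq_mul]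
    ring

theorem fderiv_ocp_initial (k : Fin n) :
    fderiv ℝ ((ocp M T ell ellT x0).eqc (.inr (.inl k))) z d = d.1 0 k := by
  refine fderiv_apply_of_quadratic (q := 0) ?_ fun r => ?_
  · change DifferentiableAt ℝ (fun z : Traj n m ι T => z.1 0 k - x0 k) z
    fun_prop
  · change (z.1 0 k + r * d.1 0 k) - x0 k = (z.1 0 k - x0 k) + _ + _
    ring

theorem fderiv_ocp_orthogonality (t : Fin T) :
    fderiv ℝ ((ocp M T ell ellT x0).eqc (.inr (.inr t))) z d =
      ∑ i, (M.slack (z.1 t.castSucc) (z.2.1 t) (z.2.2 t) i * d.2.2 t i +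
        M.slackLin (d.1 t.castSucc) (d.2.1 t) (d.2.2 t) i * z.2.2 t i) := by
  refine fderiv_apply_of_quadratic
    (q := M.slackLin (d.1 t.castSucc) (d.2.1 t) (d.2.2 t) ⬝ᵥ d.2.2 t) ?_ fun r => ?_
  · have := fun i => (differentiable_slack (M := M) t i).differentiableAt (x := z)
    change DifferentiableAt ℝ (fun z : Traj n m ι T =>
      ∑ i, M.slack (z.1 t.castSucc) (z.2.1 t) (z.2.2 t) i * z.2.2 t i) z
    fun_prop
  · have := M.slack_add_smul (z.1 t.castSucc) (d.1 t.castSucc) (z.2.1 t) (d.2.1 t)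
      (z.2.2 t) (d.2.2 t) r
    change M.slack (z.1 t.castSucc + r • d.1 t.castSucc)
      (z.2.1 t + r • d.2.1 t) (z.2.2 t + r • d.2.2 t) ⬝ᵥ (z.2.2 t + r • d.2.2 t) =
      (M.slack (z.1 t.castSucc) (z.2.1 t) (z.2.2 t) ⬝ᵥ z.2.2 t) + _ + _
    rw [this]
    simp only [dotProduct, Pi.add_apply, Pi.smul_apply, smul_eq_mul, Finset.mul_sum,
      ← Finset.sum_add_distrib]
    exact Finset.sum_congr rfl fun i _ => by ring

theorem fderiv_ocp_slack (t : Fin T) (i : ι) :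
    fderiv ℝ ((ocp M T ell ellT x0).ineqc (.inl (t, i))) z d =
      -M.slackLin (d.1 t.castSucc) (d.2.1 t) (d.2.2 t) i := by
  refine fderiv_apply_of_quadratic (q := 0) ?_ fun r => ?_
  · exact (differentiable_slack (M := M) t i).neg.differentiableAt
  · have := congrFun (M.slack_add_smul (z.1 t.castSucc) (d.1 t.castSucc) (z.2.1 t) (d.2.1 t)
      (z.2.2 t) (d.2.2 t) r) i
    change -M.slack (z.1 t.castSucc + r • d.1 t.castSucc)
      (z.2.1 t + r • d.2.1 t) (z.2.2 t + r • d.2.2 t) i =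
      -M.slack (z.1 t.castSucc) (z.2.1 t) (z.2.2 t) i + _ + _
    rw [this]
    simp only [Pi.add_apply, Pi.smul_apply, smul_eq_mul]
    ring

theorem fderiv_ocp_nonneg (t : Fin T) (i : ι) :
    fderiv ℝ ((ocp M T ell ellT x0).ineqc (.inr (t, i))) z d = -d.2.2 t i := by
  refine fderiv_apply_of_quadratic (q := 0) ?_ fun r => ?_
  · change DifferentiableAt ℝ (fun z : Traj n m ι T => -z.2.2 t i) z
    fun_prop
  · change -(z.2.2 t i + r * d.2.2 t i) = -z.2.2 t i + _ + _
    ring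

/-! ### Sufficiency of the KKT conditions -/

variable {z d}

/-- The KKT conditions are sufficient for local optimality, for every complementarity model. -/
theorem isLocallyOptimal_of_isKKT {lam : EqIdx n T → ℝ} {mu : IneqIdx ι T → ℝ}
    (h : (ocp M T ell ellT x0).IsKKT z lam mu) :
    (ocp M T ell ellT x0).IsLocallyOptimal z := by
  refine ⟨h.primal, ?_⟩
  obtain ⟨φ, hφ, hst⟩ := h.stationary
  obtain ⟨hz1, hz2, hz3⟩ := (ocp_feasible_iff z).1 h.primal
  filter_upwards [nhdsWithin_le_nhds (eventually_slack_pos z),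
    nhdsWithin_le_nhds (eventually_pos z), self_mem_nhdsWithin]
    with z' hs hw hz'
  obtain ⟨hz1', hz2', hz3'⟩ := (ocp_feasible_iff z').1 hz'
  obtain ⟨d, rfl⟩ : ∃ d, z' = z + d := ⟨z' - z, by abel⟩
  have hnext : ∀ t, M.nextLin (d.1 t.castSucc) (d.2.1 t) (d.2.2 t) = d.1 t.succ := fun t => by
    have h1 := M.next_add_smul (z.1 t.castSucc) (d.1 t.castSucc) (z.2.1 t) (d.2.1 t)
      (z.2.2 t) (d.2.2 t) 1
    simp only [one_smul] at h1
    have h2 : z.1 t.succ + d.1 t.succ = M.next (z.1 t.castSucc + d.1 t.castSucc)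
      (z.2.1 t + d.2.1 t) (z.2.2 t + d.2.2 t) := hz1' t
    rw [h1, ← hz1 t] at h2
    exact (add_left_cancel h2).symm
  have hslack : ∀ t i, M.slack ((z + d).1 t.castSucc) ((z + d).2.1 t) ((z + d).2.2 t) i =
      M.slack (z.1 t.castSucc) (z.2.1 t) (z.2.2 t) i +
        M.slackLin (d.1 t.castSucc) (d.2.1 t) (d.2.2 t) i := fun t i => by
    have h1 := M.slack_add_smul (z.1 t.castSucc) (d.1 t.castSucc) (z.2.1 t) (d.2.1 t)
      (z.2.2 t) (d.2.2 t) 1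
    simp only [one_smul] at h1
    exact congrFun h1 i
  have heq : ∀ i, fderiv ℝ ((ocp M T ell ellT x0).eqc i) z d = 0 := by
    rintro (⟨t, k⟩ | k | t)
    · rw [fderiv_ocp_dynamics, hnext, sub_self]
    · rw [fderiv_ocp_initial]
      have h1 : z.1 0 k + d.1 0 k = x0 k := congrFun hz2' k
      rw [hz2] at h1
      linarith
    · rw [fderiv_ocp_orthogonality]
      refine Finset.sum_eq_zero fun i _ => ?_
      have h1 := (hz3 t).mul_eq_zero i
      have h2 := (hz3' t).mul_eq_zero i
      -- The cross products of the slack at one point with `w` at the other vanish, since a positive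
      -- factor at `z` stays positive at `z + d` and kills its partner there. Subtracting `slack * w
      -- = 0` at `z` annihilates both terms of the linearized orthogonality.
      have h3 : M.slack (z.1 t.castSucc) (z.2.1 t) (z.2.2 t) i * (z + d).2.2 t i = 0 := by
        rcases ((hz3 t).1 i).eq_or_lt with h0 | h0
        · rw [← h0, zero_mul]
        · rw [(mul_eq_zero.1 h2).resolve_left (hs t i h0).ne', mul_zero]
      have h4 : M.slack ((z + d).1 t.castSucc) ((z + d).2.1 t) ((z + d).2.2 t) i *
          z.2.2 t i = 0 := by
        rcases ((hz3 t).2.1 i).eq_or_lt with h0 | h0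
        · rw [← h0, mul_zero]
        · rw [(mul_eq_zero.1 h2).resolve_right (hw t i h0).ne', zero_mul]
      rw [hslack] at h4
      have h5 : (z + d).2.2 t i = z.2.2 t i + d.2.2 t i := rfl
      rw [h5] at h3
      linarith
  have hineq : ∀ j, mu j * fderiv ℝ ((ocp M T ell ellT x0).ineqc j) z d ≤ 0 := by
    intro j
    -- The inequality constraints are affine, so their linearization is exact.
    have h1 : (ocp M T ell ellT x0).ineqc j (z + d) =
        (ocp M T ell ellT x0).ineqc j z + fderiv ℝ ((ocp M T ell ellT x0).ineqc j) z d := by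
      rcases j with ⟨t, i⟩ | ⟨t, i⟩
      · rw [fderiv_ocp_slack]
        change -M.slack ((z + d).1 t.castSucc) ((z + d).2.1 t) ((z + d).2.2 t) i =
          -M.slack (z.1 t.castSucc) (z.2.1 t) (z.2.2 t) i + _
        rw [hslack, neg_add]
      · rw [fderiv_ocp_nonneg]
        change -(z.2.2 t i + d.2.2 t i) = -z.2.2 t i + _
        ring
    have h2 := mul_nonpos_of_nonneg_of_nonpos (h.dual j) (hz'.2 j)
    rwa [h1, mul_add, h.slack j, zero_add] at h2
  have h1 := DFunLike.congr_fun hst d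
  simp only [_root_.add_apply, _root_.sum_apply,
    _root_.smul_apply, smul_eq_mul, heq, mul_zero, Finset.sum_const_zero, add_zero,
    _root_.zero_apply] at h1
  have h2 := hφ (z + d)
  rw [add_sub_cancel_left] at h2
  have h3 := Finset.sum_nonpos fun j (_ : j ∈ Finset.univ) => hineq j
  linarith

/-! ### Necessity of the KKT conditions -/

theorem convexOn_ocp (hell : ∀ t, ConvexOn ℝ Set.univ (ell t))
    (hellT : ConvexOn ℝ Set.univ ellT) : ConvexOn ℝ Set.univ (ocp M T ell ellT x0).f := by
  refine ⟨convex_univ, fun z _ z' _ a b ha hb hab => ?_⟩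
  change ellT (a • z.1 (Fin.last T) + b • z'.1 (Fin.last T)) +
      ∑ t, ell t (a • (z.1 t.castSucc, z.2.1 t) + b • (z'.1 t.castSucc, z'.2.1 t)) ≤
    a * (ellT (z.1 (Fin.last T)) + ∑ t, ell t (z.1 t.castSucc, z.2.1 t)) +
      b * (ellT (z'.1 (Fin.last T)) + ∑ t, ell t (z'.1 t.castSucc, z'.2.1 t))
  have h1 := hellT.2 (Set.mem_univ (z.1 (Fin.last T))) (Set.mem_univ (z'.1 (Fin.last T))) ha hb hab
  have h2 := Finset.sum_le_sum fun t (_ : t ∈ Finset.univ) => (hell t).2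
    (Set.mem_univ (z.1 t.castSucc, z.2.1 t)) (Set.mem_univ (z'.1 t.castSucc, z'.2.1 t)) ha hb hab
  simp only [smul_eq_mul, Finset.sum_add_distrib, ← Finset.mul_sum] at h1 h2
  linarith

/-- The KKT conditions are necessary for local optimality at trajectories along which the
complementarity variable is shiftable. -/
theorem exists_isKKT_of_isLocallyOptimal (hell : ∀ t, ConvexOn ℝ Set.univ (ell t))
    (hellT : ConvexOn ℝ Set.univ ellT) (hshift : ∀ t, M.Shiftable (z.2.2 t))
    (h : (ocp M T ell ellT x0).IsLocallyOptimal z) :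
    ∃ lam mu, (ocp M T ell ellT x0).IsKKT z lam mu := by
  have hconv := convexOn_ocp (M := M) (x0 := x0) hell hellT
  refine NLP.exists_isKKT _ hconv h.1 fun d hd1 hd2 => ?_
  obtain ⟨hz1, hz2, hz3⟩ := (ocp_feasible_iff z).1 h.1
  have hs0 : ∀ t i, M.slack (z.1 t.castSucc) (z.2.1 t) (z.2.2 t) i = 0 →
      0 ≤ M.slackLin (d.1 t.castSucc) (d.2.1 t) (d.2.2 t) i := fun t i hi => by
    have := hd2 (.inl (t, i)) (neg_eq_zero.2 hi)
    rwa [fderiv_ocp_slack, neg_nonpos] at this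
  have hw0 : ∀ t i, z.2.2 t i = 0 → 0 ≤ d.2.2 t i := fun t i hi => by
    have := hd2 (.inr (t, i)) (neg_eq_zero.2 hi)
    rwa [fderiv_ocp_nonneg, neg_nonpos] at this
  -- On the linearized cone every term of the linearized orthogonality is nonnegative, so the
  -- vanishing of the sum forces each term to vanish.
  have hsw : ∀ t i, M.slackLin (d.1 t.castSucc) (d.2.1 t) (d.2.2 t) i * z.2.2 t i = 0 := by
    intro t i
    have h1 := hd1 (.inr (.inr t))
    have hA : ∀ i, 0 ≤ M.slack (z.1 t.castSucc) (z.2.1 t) (z.2.2 t) i * d.2.2 t i := fun i => by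
      rcases mul_eq_zero.1 ((hz3 t).mul_eq_zero i) with h0 | h0
      · rw [h0, zero_mul]
      · exact mul_nonneg ((hz3 t).1 i) (hw0 t i h0)
    have hB : ∀ i, 0 ≤ M.slackLin (d.1 t.castSucc) (d.2.1 t) (d.2.2 t) i * z.2.2 t i := fun i => by
      rcases mul_eq_zero.1 ((hz3 t).mul_eq_zero i) with h0 | h0
      · exact mul_nonneg (hs0 t i h0) ((hz3 t).2.1 i)
      · rw [h0, mul_zero]
    rw [fderiv_ocp_orthogonality,
      Finset.sum_eq_zero_iff_of_nonneg fun i _ => add_nonneg (hA i) (hB i)] at h1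
    linarith [h1 i (Finset.mem_univ i), hA i, hB i]
  choose dw' hdw0 hdwB hdwE using fun t => hshift t (d.2.2 t)
  -- Since `dw'` vanishes wherever `w` does, moving along `d'` keeps those components at zero, while
  -- the slack stays zero where `w` is positive: complementarity survives exactly for small `r`.
  set d' : Traj n m ι T := (d.1, d.2.1, dw') with hd'
  have hpath : Tendsto (fun r : ℝ => z + r • d') (𝓝[>] 0) (𝓝 z) := by
    have : Tendsto (fun r : ℝ => z + r • d') (𝓝 0) (𝓝 (z + (0 : ℝ) • d')) :=
      Continuous.tendsto (by fun_prop) 0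
    rw [zero_smul, add_zero] at this
    exact this.mono_left nhdsWithin_le_nhds
  have hlin : ∀ t, M.slackLin (d.1 t.castSucc) (d.2.1 t) (dw' t) =
      M.slackLin (d.1 t.castSucc) (d.2.1 t) (d.2.2 t) := fun t => by
    rw [LCModel.slackLin, hdwE, LCModel.slackLin]
  have hslack : ∀ t i (r : ℝ), M.slack ((z + r • d').1 t.castSucc) ((z + r • d').2.1 t)
      ((z + r • d').2.2 t) i = M.slack (z.1 t.castSucc) (z.2.1 t) (z.2.2 t) i +
        r * M.slackLin (d.1 t.castSucc) (d.2.1 t) (d.2.2 t) i := fun t i r => by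
    rw [← hlin]
    exact congrFun (M.slack_add_smul (z.1 t.castSucc) (d.1 t.castSucc) (z.2.1 t) (d.2.1 t)
      (z.2.2 t) (dw' t) r) i
  have hfeas : ∀ᶠ r : ℝ in 𝓝[>] 0, (ocp M T ell ellT x0).Feasible (z + r • d') := by
    filter_upwards [hpath.eventually (eventually_slack_pos z),
      hpath.eventually (eventually_pos z), self_mem_nhdsWithin]
      with r hs hw hr
    refine (ocp_feasible_iff _).2 ⟨fun t => ?_, ?_, fun t => ⟨fun i => ?_, fun i => ?_, ?_⟩⟩
    · have h1 := M.next_add_smul (z.1 t.castSucc) (d.1 t.castSucc) (z.2.1 t) (d.2.1 t)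
        (z.2.2 t) (dw' t) r
      have h2 : M.nextLin (d.1 t.castSucc) (d.2.1 t) (dw' t) = d.1 t.succ := by
        funext k
        have h3 := hd1 (.inl (t, k))
        rw [fderiv_ocp_dynamics, sub_eq_zero] at h3
        rw [h3, LCModel.nextLin, hdwB, LCModel.nextLin]
      rw [h2, ← hz1 t] at h1
      exact h1.symm
    · funext k
      have h3 := hd1 (.inr (.inl k))
      rw [fderiv_ocp_initial] at h3
      change z.1 0 k + r * d.1 0 k = x0 k
      rw [h3, mul_zero, add_zero, hz2]
    · rcases ((hz3 t).1 i).eq_or_lt with h0 | h0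
      · rw [hslack, ← h0, zero_add]
        exact mul_nonneg (le_of_lt hr) (hs0 t i h0.symm)
      · exact (hs t i h0).le
    · rcases ((hz3 t).2.1 i).eq_or_lt with h0 | h0
      · change 0 ≤ z.2.2 t i + r * dw' t i
        rw [hdw0 t i h0.symm, ← h0, mul_zero, add_zero]
      · exact (hw t i h0).le
    · refine Finset.sum_eq_zero fun i _ => ?_
      rcases ((hz3 t).2.1 i).eq_or_lt with h0 | h0
      · have h4 : (z + r • d').2.2 t i = z.2.2 t i + r * dw' t i := rfl
        rw [h4, hdw0 t i h0.symm, ← h0, mul_zero, add_zero, mul_zero]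
      · rw [hslack, (mul_eq_zero.1 (hsw t i)).resolve_right h0.ne',
          (mul_eq_zero.1 ((hz3 t).mul_eq_zero i)).resolve_right h0.ne', mul_zero, add_zero, zero_mul]
  have hmin : ∀ᶠ r : ℝ in 𝓝[>] 0,
      (ocp M T ell ellT x0).f z ≤ (ocp M T ell ellT x0).f (z + r • d') :=
    (tendsto_nhdsWithin_iff.2 ⟨hpath, hfeas⟩).eventually h.2
  have hle1 : ∀ᶠ r : ℝ in 𝓝[>] 0, r < 1 :=
    nhdsWithin_le_nhds (Iio_mem_nhds one_pos)
  obtain ⟨r, h1, h2, h3⟩ := (hmin.and (hle1.and self_mem_nhdsWithin)).exists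
  have hr : 0 < r := h3
  -- Convexity carries the inequality from the short feasible step `r • d'` to the full step `d'`,
  -- which need not be feasible.
  have h4 := hconv.2 (Set.mem_univ z) (Set.mem_univ (z + d')) (sub_nonneg.2 h2.le) hr.le
    (sub_add_cancel 1 r)
  have h5 : (1 - r) • z + r • (z + d') = z + r • d' := by
    rw [sub_smul, one_smul, smul_add]
    abel
  rw [h5, smul_eq_mul, smul_eq_mul] at h4
  -- The cost ignores the `w` component, the only one in which `d` and `d'` differ.
  change _ ≤ (ocp M T ell ellT x0).f (z + d')
  exact le_of_mul_le_mul_left (by linarith) hr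

end OptimalControl

/-! ### The α-β architecture: every block has a positive multiplier -/

namespace Network

variable {n m nα nβ : ℕ} {N : Network n m (Fin n ⊕ Fin n) (CIdx n nα nβ)}
  {H : Fin n ⊕ Fin n → ℝ}

theorem transpose_selector_mulVec (w : CIdx n nα nβ → ℝ) (k : Fin n ⊕ Fin n) :
    ((selector n nα nβ)ᵀ *ᵥ w) k = ∑ i, if Sum.map Prod.fst Prod.fst i = k then w i else 0 := by
  simp [mulVec, dotProduct, selector]

/-- Because `Q` is diagonal and `F = -S`, row `i` couples only to the sum of `w` over the
constraints on the same component of `(α, β)`. -/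
theorem IsAlphaBeta.slack_eq (hN : N.IsAlphaBeta H) (x : Fin n → ℝ) (u : Fin m → ℝ)
    (w : CIdx n nα nβ → ℝ) (i : CIdx n nα nβ) :
    N.toLC.slack x u w i = (H (Sum.map Prod.fst Prod.fst i))⁻¹ *
      ((selector n nα nβ)ᵀ *ᵥ w) (Sum.map Prod.fst Prod.fst i) +
      N.costCenter x u (Sum.map Prod.fst Prod.fst i) - N.bound x u i := by
  have hcols : ∀ B : Matrix (CIdx n nα nβ) (Fin n ⊕ Fin m) ℝ,
      B.toCols₁ *ᵥ x + B.toCols₂ *ᵥ u = B *ᵥ Sum.elim x u := fun B => by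
    ext k
    simp [mulVec, dotProduct, toCols₁, toCols₂, Fintype.sum_sum_type]
  have hsel : ∀ v : Fin n ⊕ Fin n → ℝ,
      (selector n nα nβ *ᵥ v) i = v (Sum.map Prod.fst Prod.fst i) := fun v => by
    simp [mulVec, dotProduct, selector]
  have hQ : ∀ v : Fin n ⊕ Fin n → ℝ, ∀ k, (N.Q⁻¹ *ᵥ v) k = (H k)⁻¹ * v k := fun v k => by
    have hinv : N.Q⁻¹ = diagonal fun k => (H k)⁻¹ := by
      rw [hN.Q_eq]
      refine inv_eq_right_inv ?_
      rw [diagonal_mul_diagonal, ← diagonal_one]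
      exact congrArg diagonal (funext fun k => mul_inv_cancel₀ (hN.H_pos k).ne')
    rw [hinv, mulVec_diagonal]
  simp only [LCModel.slack, toLC]
  rw [add_assoc ((N.F * N.Q⁻¹ * N.Fᵀ) *ᵥ w), hcols]
  simp only [costCenter, bound, hN.F_eq, sub_mulVec, neg_mulVec, ← mulVec_mulVec, transpose_neg,
    mulVec_neg, Pi.add_apply, Pi.sub_apply, Pi.neg_apply, hsel, hQ, neg_neg]
  ring

/-- Where `ψ < max_i a_i` and `φ < max_j b_j` hold, every solution of the complementarity problem
is positive at some component of every block. -/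
theorem IsAlphaBeta.exists_pos (hN : N.IsAlphaBeta H) (hnα : 1 ≤ nα) (hnβ : 1 ≤ nβ)
    {Ω : Set ((Fin n → ℝ) × (Fin m → ℝ))} (hstrict : N.StrictInequalities Ω)
    {x : Fin n → ℝ} {u : Fin m → ℝ} (hmem : (x, u) ∈ Ω) {w : CIdx n nα nβ → ℝ}
    (hw : N.toLC.Solves x u w) (k : Fin n ⊕ Fin n) :
    ∃ i, Sum.map Prod.fst Prod.fst i = k ∧ 0 < w i := by
  obtain ⟨i, hik, hi⟩ : ∃ i : CIdx n nα nβ, Sum.map Prod.fst Prod.fst i = k ∧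
      N.costCenter x u k < N.bound x u i := by
    rcases k with k | k
    · have : Nonempty (Fin nα) := ⟨⟨0, hnα⟩⟩
      obtain ⟨i, hi⟩ := exists_lt_of_lt_ciSup ((hstrict x u hmem).1 k)
      exact ⟨.inl (k, i), rfl, hi⟩
    · have : Nonempty (Fin nβ) := ⟨⟨0, hnβ⟩⟩
      obtain ⟨i, hi⟩ := exists_lt_of_lt_ciSup ((hstrict x u hmem).2 k)
      exact ⟨.inr (k, i), rfl, hi⟩
  -- If `w` vanished on the whole block, the slack at the index `i` of a dominating bound would be
  -- `costCenter - bound < 0`.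
  by_contra! hn
  have h1 := hw.1 i
  rw [hN.slack_eq, hik, transpose_selector_mulVec, Finset.sum_eq_zero fun j _ => ?_, mul_zero] at h1
  · linarith
  · split_ifs with hj
    exacts [le_antisymm (hn j hj) (hw.2.1 j), rfl]

/-- `Bw` and `Ew` both factor through `Fᵀ`, which only records block sums, so each block sum of `dw`
can be concentrated on one index where `w` is positive. -/
theorem IsAlphaBeta.shiftable (hN : N.IsAlphaBeta H) {w : CIdx n nα nβ → ℝ}
    (hpos : ∀ k, ∃ i, Sum.map Prod.fst Prod.fst i = k ∧ 0 < w i) : N.toLC.Shiftable w := by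
  intro dw
  choose s hs hsw using hpos
  set dw' : CIdx n nα nβ → ℝ := fun i => if i = s (Sum.map Prod.fst Prod.fst i) then
    ((selector n nα nβ)ᵀ *ᵥ dw) (Sum.map Prod.fst Prod.fst i) else 0 with hdw'
  have key : N.Fᵀ *ᵥ dw' = N.Fᵀ *ᵥ dw := by
    rw [hN.F_eq, transpose_neg, neg_mulVec, neg_mulVec]
    congr 1
    funext k
    rw [transpose_selector_mulVec, Finset.sum_eq_single (s k)]
    · simp only [hdw', hs, if_true]
    · intro i _ hi
      split_ifs with hik
      · simp only [hdw', hik, if_neg hi]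
      · rfl
    · simp
  refine ⟨dw', fun i hi => ?_, ?_, ?_⟩
  · refine if_neg fun e => (hsw (Sum.map Prod.fst Prod.fst i)).ne' ?_
    rw [← e, hi]
  · change (-(N.W * N.Q⁻¹ * N.Fᵀ)) *ᵥ dw' = (-(N.W * N.Q⁻¹ * N.Fᵀ)) *ᵥ dw
    rw [neg_mulVec, neg_mulVec, ← mulVec_mulVec, key, mulVec_mulVec]
  · change (N.F * N.Q⁻¹ * N.Fᵀ) *ᵥ dw' = (N.F * N.Q⁻¹ * N.Fᵀ) *ᵥ dw
    rw [← mulVec_mulVec, key, mulVec_mulVec]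

end Network

end HybridNN

theorem corollary1
    {n m nα nβ T : ℕ} (hnα : 1 ≤ nα) (hnβ : 1 ≤ nβ)
    -- the convex polytope of state-input pairs
    (Ω : Set ((Fin n → ℝ) × (Fin m → ℝ)))
    (hΩ : ∃ V : Finset ((Fin n → ℝ) × (Fin m → ℝ)), Ω = convexHull ℝ (V : Set _))
    -- the trained network
    (H : Fin n ⊕ Fin n → ℝ)
    (N : HybridNN.Network n m (Fin n ⊕ Fin n) (HybridNN.CIdx n nα nβ))
    (hN : N.IsAlphaBeta H)
    (h1 : N.toLC.Deterministic Ω) (h2 : N.toLC.Decomposable) (h3 : N.toLC.Nontrivial Ω)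
    (hstrict : N.StrictInequalities Ω)
    -- the costs and the initial state
    (ell : Fin T → (Fin n → ℝ) × (Fin m → ℝ) → ℝ) (ellT : (Fin n → ℝ) → ℝ)
    (hell : ∀ t, ConvexOn ℝ Set.univ (ell t)) (hellT : ConvexOn ℝ Set.univ ellT)
    (x0 : Fin n → ℝ)
    -- the feasible triple
    (x : Fin (T + 1) → Fin n → ℝ) (u : Fin T → Fin m → ℝ)
    (w : Fin T → HybridNN.CIdx n nα nβ → ℝ)
    (hfeas : (HybridNN.ocp N.toLC T ell ellT x0).Feasible (x, u, w))
    (hmem : ∀ t : Fin T, (x t.castSucc, u t) ∈ Ω) :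
    (HybridNN.ocp N.toLC T ell ellT x0).IsLocallyOptimal (x, u, w) ↔
      ∃ (lam : HybridNN.EqIdx n T → ℝ) (mu : HybridNN.IneqIdx (HybridNN.CIdx n nα nβ) T → ℝ),
        (HybridNN.ocp N.toLC T ell ellT x0).IsKKT (x, u, w) lam mu := by
  refine ⟨HybridNN.exists_isKKT_of_isLocallyOptimal hell hellT fun t => ?_, fun ⟨lam, mu, h⟩ =>
    HybridNN.isLocallyOptimal_of_isKKT h⟩
  exact hN.shiftable (hN.exists_pos hnα hnβ hstrict (hmem t)
    (((HybridNN.ocp_feasible_iff _).1 hfeas).2.2 t))
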